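/- Let $A\neq 0$ be a unital $C^*$-algebra and let $S$ be a monoid that is left Ore (for all $s,t\in S$ there are $s',t'\in S$ with $s't=t's$) and left reversible (if $ts=us$ for some $s\in S$, then $s't=s'u$ for some $s'\in S$). Let $\alpha$ be an action of $S$ on $A$ by injective, not necessarily unital, $*$-endomorphisms. A covariant pair for $(A,S,\alpha)$ in a unital $C^*$-algebra $D$ is a unital $*$-homomorphism $\pi:A\to D$ together with a homomorphism $V$ from $S$ to the isometries of $D$ such that $\pi(\alpha_s(a))=V_s\pi(a)V_s^*$ for all $s\in S$, $a\in A$. The semigroup crossed product $A\times_\alpha S$ is a $C^*$-algebra with a covariant pair $(i_A,i_S)$ such that $i_A(A)\cup i_S(S)$ generates $A\times_\alpha S$ as a $C^*$-algebra and every covariant pair $(\pi,V)$ in $B(H)$, with $H$ a Hilbert space, is of the form $(\rho\circ i_A,\rho\circ i_S)$ for a unital $*$-homomorphism $\rho:A\times_\alpha S\to B(H)$. Let $S^*AS\subseteq A\times_\alpha S$ be the norm closure of $\{\,i_S(s)^*\,i_A(a)\,i_S(s) : s\in S,\ a\in A\,\}$; it is a unital $C^*$-subalgebra containing $i_A(A)$.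 Then $i_A$ is injective, so that $A$ may be identified with the unital $C^*$-subalgebra $i_A(A)$ of $S^*AS$, and there is an action $\overline{\alpha}$ of $S$ on $S^*AS$ by $*$-endomorphisms such that: 1. $\overline{\alpha}$ extends $\alpha$, i.e. $\overline{\alpha}_s(i_A(a))=i_A(\alpha_s(a))$ for all $s\in S$, $a\in A$; and every $\overline{\alpha}_s$ is a corner $*$-isomorphism, i.e. a $*$-isomorphism of $S^*AS$ onto $p(S^*AS)p$ for some nonzero projection $p\in S^*AS$. In particular $\overline{\alpha}_s$ has hereditary range: if $0\le x\le y$ in $S^*AS$ and $y$ is in the range of $\overline{\alpha}_s$, then so is $x$. 2. $A\times_\alpha S=(S^*AS)\times_{\overline{\alpha}}S$, i.e. the $C^*$-algebra $A\times_\alpha S$ with the inclusion $S^*AS\hookrightarrow A\times_\alpha S$ and $i_S$ is the semigroup crossed product of $(S^*AS,S,\overline{\alpha})$. -/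

import Mathlib

open scoped ENNReal

universe u v w

/-- The left Ore condition on a monoid: any two elements have a common left multiple. -/
def IsLeftOre (S : Type*) [Monoid S] : Prop :=
  ∀ s t : S, ∃ s' t' : S, s' * t = t' * s

/-- Left reversibility of a (not necessarily cancellative) monoid: elements that are identified
by a multiplication on the right are identified by a multiplication on the left. -/
def IsLeftReversible (S : Type*) [Monoid S] : Prop :=
  ∀ t u s : S, t * s = u * s → ∃ s' : S, s' * t = s' * u

/-- A covariant pair `(π, V)` of the dynamical system `(A, S, α)` in a unital C⋆-algebra `D`:
`π` is a unital `*`-homomorphism, `V` is a representation of `S` by isometries, and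
`π (α s a) = V s * π a * (V s)⋆`. For `D = H →L[ℂ] H` with `H` a Hilbert space this is a
covariant representation on `H`. Here `A →⋆ₙₐ[ℂ] A` is the monoid (under composition) of the
not necessarily unital `*`-endomorphisms of `A`. -/
structure IsCovariantPair {A S D : Type*} [CStarAlgebra A] [Monoid S] [CStarAlgebra D]
    (α : S →* (A →⋆ₙₐ[ℂ] A)) (π : A →⋆ₐ[ℂ] D) (V : S →* D) : Prop where
  isometry : ∀ s, star (V s) * V s = 1
  covariance : ∀ s a, π (α s a) = V s * π a * star (V s)

/-- The C⋆-algebra `B`, together with `iA : A → B` and `iS : S → B`, is the semigroup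
C⋆-crossed product of `(A, S, α)`: the pair `(iA, iS)` is covariant, every covariant
representation of `(A, S, α)` on a Hilbert space factors through it, and `B` is generated by
`iA(A)` and `iS(S)` as a C⋆-algebra. -/
structure IsCrossedProduct {A : Type u} {S : Type v} {B : Type w}
    [CStarAlgebra A] [Monoid S] [CStarAlgebra B]
    (α : S →* (A →⋆ₙₐ[ℂ] A)) (iA : A →⋆ₐ[ℂ] B) (iS : S →* B) : Prop where
  covariant : IsCovariantPair α iA iS
  universal : ∀ (H : Type (max u v)) [NormedAddCommGroup H] [InnerProductSpace ℂ H]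
    [CompleteSpace H] (π : A →⋆ₐ[ℂ] (H →L[ℂ] H)) (V : S →* (H →L[ℂ] H)),
    IsCovariantPair α π V →
      ∃ ρ : B →⋆ₐ[ℂ] (H →L[ℂ] H), (∀ a, ρ (iA a) = π a) ∧ (∀ s, ρ (iS s) = V s)
  generates : (StarAlgebra.adjoin ℂ (Set.range iA ∪ Set.range iS)).topologicalClosure = ⊤

section FractionSubalgebra

variable {A S D : Type*} [CStarAlgebra A] [Monoid S] [CStarAlgebra D]
  {α : S →* (A →⋆ₙₐ[ℂ] A)} {π : A →⋆ₐ[ℂ] D} {V : S →* D}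

theorem IsCovariantPair.expand (h : IsCovariantPair α π V) (r s : S) (a : A) :
    star (V s) * π a * V s = star (V (r * s)) * π (α r a) * V (r * s) := by
  have hr := h.isometry r
  have e : star (V (r * s)) * π (α r a) * V (r * s) =
      star (V s) * (star (V r) * V r) * π a * (star (V r) * V r) * V s := by
    rw [h.covariance, map_mul, star_mul]; simp only [mul_assoc]
  rw [e, hr]; simp

theorem IsCovariantPair.proj (h : IsCovariantPair α π V) (s : S) :
    V s * star (V s) = π (α s 1) := by
  rw [h.covariance]; simp

/-- The unital `*`-subalgebra `S₋AS₊ = {(V s)⋆ π(a) V s | s ∈ S, a ∈ A}` attached to a covariant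
pair `(π, V)`. -/
def fractionSubalgebra (hS : IsLeftOre S) (h : IsCovariantPair α π V) : StarSubalgebra ℂ D where
  carrier := {x | ∃ (s : S) (a : A), x = star (V s) * π a * V s}
  mul_mem' := by
    rintro _ _ ⟨s, a, rfl⟩ ⟨t, b, rfl⟩
    obtain ⟨s', t', e⟩ := hS s t
    refine ⟨s' * t, α t' a * α (s' * t) 1 * α s' b, ?_⟩
    rw [h.expand s' t b, h.expand t' s a, ← e, map_mul π, map_mul π, ← h.proj]
    simp only [mul_assoc]
  one_mem' := ⟨1, 1, by simp⟩
  add_mem' := by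
    rintro _ _ ⟨s, a, rfl⟩ ⟨t, b, rfl⟩
    obtain ⟨s', t', e⟩ := hS s t
    refine ⟨s' * t, α t' a + α s' b, ?_⟩
    rw [h.expand s' t b, h.expand t' s a, ← e, map_add, mul_add, add_mul]
  algebraMap_mem' r := ⟨1, algebraMap ℂ A r, by simp [AlgHomClass.commutes π r]⟩
  star_mem' := by
    rintro _ ⟨s, a, rfl⟩
    exact ⟨s, star a, by simp [mul_assoc, map_star]⟩

/-- The unital C⋆-subalgebra `S⋆AS`: the norm closure of `S₋AS₊`. -/
def fractionCStarSubalgebra (hS : IsLeftOre S) (h : IsCovariantPair α π V) :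
    StarSubalgebra ℂ D :=
  (fractionSubalgebra hS h).topologicalClosure

noncomputable instance (hS : IsLeftOre S) (h : IsCovariantPair α π V) :
    CStarAlgebra (fractionCStarSubalgebra hS h) :=
  StarSubalgebra.cstarAlgebra _
    (h_closed := StarSubalgebra.isClosed_topologicalClosure (fractionSubalgebra hS h))

theorem mem_fractionCStarSubalgebra (hS : IsLeftOre S) (h : IsCovariantPair α π V) (a : A) :
    π a ∈ fractionCStarSubalgebra hS h :=
  StarSubalgebra.le_topologicalClosure _ ⟨1, a, by simp⟩

/-- The canonical unital `*`-homomorphism `A → S⋆AS`, `a ↦ π a`. -/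
def toFractionCStarSubalgebra (hS : IsLeftOre S) (h : IsCovariantPair α π V) :
    A →⋆ₐ[ℂ] fractionCStarSubalgebra hS h :=
  π.codRestrict _ (mem_fractionCStarSubalgebra hS h)

end FractionSubalgebra

/-- A corner `*`-isomorphism: a `*`-endomorphism `f` of `D` that is a bijection from `D` onto
the corner `pDp` of a nonzero projection `p`. -/
def IsCornerStarIso {D : Type*} [CStarAlgebra D] (f : D →⋆ₙₐ[ℂ] D) : Prop :=
  ∃ p : D, IsStarProjection p ∧ p ≠ 0 ∧ Function.Injective f ∧
    Set.range f = {y | ∃ x : D, y = p * x * p}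

/-- `C` is hereditary in the C⋆-algebra `D`: if `0 ≤ x ≤ y` with `y ∈ C` then `x ∈ C`. The
positive elements of a C⋆-algebra are the elements of the form `z⋆z`. -/
def IsHereditary {D : Type*} [CStarAlgebra D] (C : Set D) : Prop :=
  ∀ x y : D, (∃ z, x = star z * z) → (∃ z, y - x = star z * z) → y ∈ C → x ∈ C

section Existence

/-- A covariant representation of `(A, S, α)` on a nonzero Hilbert space. -/
structure CovariantRep {A : Type u} {S : Type v} [CStarAlgebra A] [Monoid S]
    (α : S →* (A →⋆ₙₐ[ℂ] A)) : Type (max u v + 1) where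
  H : Type (max u v)
  [normed : NormedAddCommGroup H]
  [inner : InnerProductSpace ℂ H]
  [complete : CompleteSpace H]
  [nontrivial : Nontrivial H]
  π : A →⋆ₐ[ℂ] (H →L[ℂ] H)
  V : S →* (H →L[ℂ] H)
  covariant : IsCovariantPair α π V

attribute [instance] CovariantRep.normed CovariantRep.inner CovariantRep.complete
  CovariantRep.nontrivial

variable {A : Type u} {S : Type v} [CStarAlgebra A] [Monoid S] {α : S →* (A →⋆ₙₐ[ℂ] A)}

/-- The evaluation of noncommutative polynomials in `A`, `S` and the adjoints of `S` at a
covariant representation. -/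
noncomputable def CovariantRep.eval (R : CovariantRep α) :
    FreeAlgebra ℂ (A ⊕ S ⊕ S) →ₐ[ℂ] (R.H →L[ℂ] R.H) :=
  FreeAlgebra.lift ℂ (Sum.elim R.π (Sum.elim R.V fun s => star (R.V s)))

/-- The seminorms on noncommutative polynomials that come from covariant representations. -/
def covariantSeminorms (α : S →* (A →⋆ₙₐ[ℂ] A)) : Set (FreeAlgebra ℂ (A ⊕ S ⊕ S) → ℝ) :=
  Set.range fun (R : CovariantRep α) x => ‖R.eval x‖

/-- A covariant representation that induces a given seminorm. -/
noncomputable def covariantRepOf (i : covariantSeminorms α) : CovariantRep α :=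
  Classical.choose i.2

theorem norm_eval_covariantRepOf (i : covariantSeminorms α) (x : FreeAlgebra ℂ (A ⊕ S ⊕ S)) :
    ‖(covariantRepOf i).eval x‖ = i.1 x :=
  congrFun (Classical.choose_spec i.2) x

/-- The bounded families of operators on the chosen representation spaces. -/
abbrev OpFamily (α : S →* (A →⋆ₙₐ[ℂ] A)) : Type (max u v) :=
  lp (fun i : covariantSeminorms α =>
    (covariantRepOf i).H →L[ℂ] (covariantRepOf i).H) ∞

noncomputable instance : CStarAlgebra (OpFamily α) where

theorem IsCovariantPair.norm_le_one {D : Type*} [CStarAlgebra D] [Nontrivial D]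
    {π : A →⋆ₐ[ℂ] D} {V : S →* D} (h : IsCovariantPair α π V) (s : S) : ‖V s‖ ≤ 1 := by
  have h1 : ‖V s‖ * ‖V s‖ = 1 := by
    rw [← CStarRing.norm_star_mul_self, h.isometry, CStarRing.norm_one]
  nlinarith [norm_nonneg (V s)]

/-- The direct sum of the chosen representations of `A`. -/
noncomputable def sumπ (α : S →* (A →⋆ₙₐ[ℂ] A)) : A →⋆ₐ[ℂ] OpFamily α where
  toFun a := ⟨fun i => (covariantRepOf i).π a, memℓp_infty ⟨‖a‖, by
    rintro _ ⟨i, rfl⟩; exact NonUnitalStarAlgHom.norm_apply_le (covariantRepOf i).π a⟩⟩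
  map_one' := by ext1; funext i; exact map_one _
  map_mul' a b := by ext1; funext i; exact map_mul _ a b
  map_zero' := by ext1; funext i; exact map_zero _
  map_add' a b := by ext1; funext i; exact map_add _ a b
  commutes' r := by ext1; funext i; exact AlgHomClass.commutes (covariantRepOf i).π r
  map_star' a := by ext1; funext i; exact map_star (covariantRepOf i).π a

/-- The direct sum of the chosen isometric representations of `S`. -/
noncomputable def sumV (α : S →* (A →⋆ₙₐ[ℂ] A)) : S →* OpFamily α where
  toFun s := ⟨fun i => (covariantRepOf i).V s, memℓp_infty ⟨1, by
    rintro _ ⟨i, rfl⟩; exact (covariantRepOf i).covariant.norm_le_one s⟩⟩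
  map_one' := by ext1; funext i; exact map_one _
  map_mul' a b := by ext1; funext i; exact map_mul _ a b

/-- The C⋆-algebra generated by the direct sum of the chosen covariant representations. -/
noncomputable def crossedProductAlgebra (α : S →* (A →⋆ₙₐ[ℂ] A)) :
    StarSubalgebra ℂ (OpFamily α) :=
  (StarAlgebra.adjoin ℂ (Set.range (sumπ α) ∪ Set.range (sumV α))).topologicalClosure

noncomputable instance : CStarAlgebra (crossedProductAlgebra α) :=
  StarSubalgebra.cstarAlgebra _ (h_closed := StarSubalgebra.isClosed_topologicalClosure _)

theorem sumπ_mem (a : A) : sumπ α a ∈ crossedProductAlgebra α :=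
  StarSubalgebra.le_topologicalClosure _
    (StarAlgebra.subset_adjoin ℂ _ (Or.inl ⟨a, rfl⟩))

theorem sumV_mem (s : S) : sumV α s ∈ crossedProductAlgebra α :=
  StarSubalgebra.le_topologicalClosure _
    (StarAlgebra.subset_adjoin ℂ _ (Or.inr ⟨s, rfl⟩))

/-- A norm-decreasing correspondence on generators extends to the generated C⋆-algebra. -/
theorem exists_starAlgHom_of_norm_le {L D : Type*} [CStarAlgebra L] [CStarAlgebra D]
    (G : Set (L × D)) (hG : ∀ c ∈ StarAlgebra.adjoin ℂ G, ‖c.2‖ ≤ ‖c.1‖)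
    (N : StarSubalgebra ℂ L)
    (hN : N = (StarAlgebra.adjoin ℂ (Prod.fst '' G)).topologicalClosure) :
    ∃ ρ : N →⋆ₐ[ℂ] D, ∀ c ∈ G, ∀ h : c.1 ∈ N, ρ ⟨c.1, h⟩ = c.2 := by
  let C : StarSubalgebra ℂ (L × D) := (StarAlgebra.adjoin ℂ G).topologicalClosure
  have hCcl : IsClosed (C : Set (L × D)) := StarSubalgebra.isClosed_topologicalClosure _
  let _ : CStarAlgebra C := StarSubalgebra.cstarAlgebra _ (h_closed := hCcl)
  have hGC : G ⊆ C := fun x hx =>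
    StarSubalgebra.le_topologicalClosure _ (StarAlgebra.subset_adjoin ℂ _ hx)
  have hnorm : ∀ c ∈ C, ‖c.2‖ ≤ ‖c.1‖ := by
    have hcl : IsClosed {c : L × D | ‖c.2‖ ≤ ‖c.1‖} :=
      isClosed_le continuous_snd.norm continuous_fst.norm
    exact fun c hc => closure_minimal (fun c hc => hG c hc) hcl hc
  let F : C →⋆ₐ[ℂ] L := (StarAlgHom.fst ℂ _ _).comp C.subtype
  have hF : Function.Injective F := by
    rw [injective_iff_map_eq_zero]
    intro c hc
    have h1 : (c : L × D).1 = 0 := hc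
    have h2 : (c : L × D).2 = 0 := by
      have := hnorm c c.2
      rw [h1, norm_zero] at this
      exact norm_le_zero_iff.1 this
    exact Subtype.ext (Prod.ext h1 h2)
  have hFcl : IsClosed (Set.range F) :=
    (NonUnitalStarAlgHom.isometry F hF).isClosedEmbedding.isClosed_range
  have hle : N ≤ F.range := by
    rw [hN]
    refine StarSubalgebra.topologicalClosure_minimal (StarAlgebra.adjoin_le ?_) hFcl
    rintro _ ⟨c, hc, rfl⟩
    exact ⟨⟨c, hGC hc⟩, rfl⟩
  let E : C ≃⋆ₐ[ℂ] F.range := StarAlgEquiv.ofInjective F hF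
  refine ⟨((StarAlgHom.snd ℂ _ _).comp C.subtype).comp
    ((E.symm : F.range →⋆ₐ[ℂ] C).comp (StarSubalgebra.inclusion hle)), fun c hc h => ?_⟩
  have hE : E.symm ⟨c.1, hle h⟩ = ⟨c, hGC hc⟩ := by
    rw [StarAlgEquiv.symm_apply_eq]; rfl
  exact congrArg (fun c : C => (c : L × D).2) hE

/-- Extension of a covariant representation to `crossedProductAlgebra α`. -/
theorem exists_extension (R : CovariantRep α) :
    ∃ ρ : crossedProductAlgebra α →⋆ₐ[ℂ] (R.H →L[ℂ] R.H),
      (∀ a, ρ ⟨sumπ α a, sumπ_mem a⟩ = R.π a) ∧ (∀ s, ρ ⟨sumV α s, sumV_mem s⟩ = R.V s) := by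
  let i₀ : covariantSeminorms α := ⟨_, R, rfl⟩
  let T := OpFamily α × (R.H →L[ℂ] R.H)
  let gA : A → T := fun a => (sumπ α a, R.π a)
  let gS : S → T := fun s => (sumV α s, R.V s)
  let G : Set T := Set.range gA ∪ Set.range gS
  have key : ∀ c ∈ StarAlgebra.adjoin ℂ G, ∃ x : FreeAlgebra ℂ (A ⊕ S ⊕ S),
      c.1 i₀ = (covariantRepOf i₀).eval x ∧ c.2 = R.eval x := by
    intro c hc
    rw [← StarSubalgebra.mem_toSubalgebra, StarAlgebra.adjoin_toSubalgebra] at hc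
    induction hc using Algebra.adjoin_induction with
    | mem x hx =>
      rcases hx with (⟨a, rfl⟩ | ⟨s, rfl⟩) | hx
      · exact ⟨FreeAlgebra.ι ℂ (Sum.inl a), by simp [CovariantRep.eval, gA, sumπ],
          by simp [CovariantRep.eval, gA]⟩
      · exact ⟨FreeAlgebra.ι ℂ (Sum.inr (Sum.inl s)), by simp [CovariantRep.eval, gS, sumV],
          by simp [CovariantRep.eval, gS]⟩
      · rcases hx with ⟨a, ha⟩ | ⟨s, hs⟩
        · have : x = gA (star a) := by
            rw [← star_star x, ← ha]; simp only [gA, map_star]; rfl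
          subst this
          exact ⟨FreeAlgebra.ι ℂ (Sum.inl (star a)), by simp [CovariantRep.eval, gA, sumπ],
            by simp [CovariantRep.eval, gA]⟩
        · have : x = star (gS s) := by rw [hs, star_star]
          subst this
          exact ⟨FreeAlgebra.ι ℂ (Sum.inr (Sum.inr s)), by simp [CovariantRep.eval]; rfl,
            by simp [CovariantRep.eval]; rfl⟩
    | algebraMap r =>
      refine ⟨algebraMap ℂ _ r, ?_, ?_⟩
      · rw [AlgHom.commutes]; rfl
      · rw [AlgHom.commutes]; rfl
    | add x y _ _ hx hy =>
      obtain ⟨p, hp1, hp2⟩ := hx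
      obtain ⟨q, hq1, hq2⟩ := hy
      exact ⟨p + q, by rw [map_add, ← hp1, ← hq1]; rfl, by rw [map_add, ← hp2, ← hq2]; rfl⟩
    | mul x y _ _ hx hy =>
      obtain ⟨p, hp1, hp2⟩ := hx
      obtain ⟨q, hq1, hq2⟩ := hy
      exact ⟨p * q, by rw [map_mul, ← hp1, ← hq1]; rfl, by rw [map_mul, ← hp2, ← hq2]; rfl⟩
  have hnorm : ∀ c ∈ StarAlgebra.adjoin ℂ G, ‖c.2‖ ≤ ‖c.1‖ := by
    intro c hc
    obtain ⟨x, hx1, hx2⟩ := key c hc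
    have e := norm_eval_covariantRepOf i₀ x
    calc ‖c.2‖ = ‖R.eval x‖ := by rw [hx2]
      _ = ‖c.1 i₀‖ := by rw [hx1, e]
      _ ≤ ‖c.1‖ := lp.norm_apply_le_norm ENNReal.top_ne_zero c.1 i₀
  obtain ⟨ρ, hρ⟩ := exists_starAlgHom_of_norm_le G hnorm (crossedProductAlgebra α) (by
    rw [crossedProductAlgebra, Set.image_union, ← Set.range_comp, ← Set.range_comp]; rfl)
  exact ⟨ρ, fun a => hρ (gA a) (Or.inl ⟨a, rfl⟩) (sumπ_mem a),
    fun s => hρ (gS s) (Or.inr ⟨s, rfl⟩) (sumV_mem s)⟩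

/-- Every dynamical system has a semigroup C⋆-crossed product. -/
theorem exists_isCrossedProduct (α : S →* (A →⋆ₙₐ[ℂ] A)) :
    ∃ (B : Type (max u v)) (_ : CStarAlgebra B) (iA : A →⋆ₐ[ℂ] B) (iS : S →* B),
      IsCrossedProduct α iA iS := by
  let iA : A →⋆ₐ[ℂ] crossedProductAlgebra α := (sumπ α).codRestrict _ sumπ_mem
  let iS : S →* crossedProductAlgebra α := (sumV α).codRestrict _ sumV_mem
  refine ⟨crossedProductAlgebra α, inferInstance, iA, iS, ⟨?_, ?_⟩, ?_, ?_⟩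
  · intro s
    ext1; ext1; funext i
    exact (covariantRepOf i).covariant.isometry s
  · intro s a
    ext1; ext1; funext i
    exact (covariantRepOf i).covariant.covariance s a
  · intro H _ _ _ π V h
    rcases subsingleton_or_nontrivial H with hH | hH
    · refine ⟨{ toFun := fun _ => 0, map_one' := Subsingleton.elim _ _,
                map_mul' := fun _ _ => Subsingleton.elim _ _,
                map_zero' := Subsingleton.elim _ _,
                map_add' := fun _ _ => Subsingleton.elim _ _,
                commutes' := fun _ => Subsingleton.elim _ _,
                map_star' := fun _ => Subsingleton.elim _ _ },
              fun _ => Subsingleton.elim _ _, fun _ => Subsingleton.elim _ _⟩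
    · exact exists_extension ⟨H, π, V, h⟩
  · rw [eq_top_iff]
    rintro ⟨x, hx⟩ -
    have hmap : (StarAlgebra.adjoin ℂ (Set.range iA ∪ Set.range iS)).map
        (crossedProductAlgebra α).subtype =
        StarAlgebra.adjoin ℂ (Set.range (sumπ α) ∪ Set.range (sumV α)) := by
      rw [StarAlgHom.map_adjoin, Set.image_union, ← Set.range_comp, ← Set.range_comp]
      rfl
    change _ ∈ closure _
    rw [closure_subtype]
    have hx' : x ∈ closure
        (StarAlgebra.adjoin ℂ (Set.range (sumπ α) ∪ Set.range (sumV α)) : Set (OpFamily α)) := hx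
    rw [← hmap] at hx'
    exact hx'

end Existence

/-! The hard point is injectivity of `iA`: by universality it suffices to find, for each `a ≠ 0`, a
covariant pair on a Hilbert space that does not kill `a` (`exists_isCovariantPair_ne_zero`).
Heuristically, inverting the `α s` embeds `A` in an inductive limit on which the group of fractions
`G` of `S` acts by automorphisms, and one compresses the regular representation of that system.

The limit is modelled inside the bounded families `S → A`, taken modulo vanishing along an
ultrafilter that contains every `S t`: level `t` sends `b` to the family with value `α r b` at `r *
t`. A limit of states that norm `α r (a⋆a)`, followed by the GNS construction, gives a
representation `ρ` that respects this quotient but not `a` (`exists_rep_lp_infty`). Composing `ρ`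
with level `t` and `α r` defines `σ` at the fraction `t⁻¹r`, and `σ (g s) = σ g ∘ α s`. On `ℓ²(G,
K)` the diagonal representation by `σ` and right translation are then covariant; restriction to the
range of the image of `1` makes the representation unital and the unitaries isometries
(`exists_isCovariantPair_of_family`).

The action on `S⋆AS` is conjugation by `iS s`. It maps onto the corner at `iS s (iS s)⋆`, with
inverse `y ↦ (iS s)⋆ y iS s`. A covariant pair of the extended system is determined on the dense set
of fractions by its restriction to `A`, which gives the second crossed product. -/

/-! ### Restriction of a degenerate covariant pair to its essential space -/

section Compression

variable {A S E : Type*} [CStarAlgebra A] [Monoid S]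
  [NormedAddCommGroup E] [InnerProductSpace ℂ E] [CompleteSpace E]

/-- The range of the projection `π 1` attached to a not necessarily unital representation `π`. -/
noncomputable def essentialSpace (π : A →⋆ₙₐ[ℂ] (E →L[ℂ] E)) : Submodule ℂ E :=
  LinearMap.ker ((1 - π 1 : E →L[ℂ] E) : E →ₗ[ℂ] E)

variable (π : A →⋆ₙₐ[ℂ] (E →L[ℂ] E))

theorem mem_essentialSpace {x : E} : x ∈ essentialSpace π ↔ π 1 x = x := by
  simp only [essentialSpace, LinearMap.mem_ker, ContinuousLinearMap.coe_coe,
    sub_apply, one_apply_eq_self, sub_eq_zero]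
  exact eq_comm

instance : CompleteSpace (essentialSpace π) :=
  (ContinuousLinearMap.isClosed_ker (1 - π 1 : E →L[ℂ] E)).completeSpace_coe

theorem map_one_mul_map (a : A) : π 1 * π a = π a := by rw [← map_mul, one_mul]

theorem map_mul_map_one (a : A) : π a * π 1 = π a := by rw [← map_mul, mul_one]

/-- The restriction to the essential space of an operator that leaves it invariant. -/
noncomputable def restrictEssential (T : E →L[ℂ] E) (hT : π 1 * T * π 1 = T * π 1) :
    essentialSpace π →L[ℂ] essentialSpace π :=
  (T.comp (essentialSpace π).subtypeL).codRestrict _ fun x => by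
    have hx := (mem_essentialSpace π).1 x.2
    have := congrArg (fun R : E →L[ℂ] E => R x) hT
    simpa [mem_essentialSpace, hx] using this

@[simp]
theorem coe_restrictEssential (T : E →L[ℂ] E) (hT : π 1 * T * π 1 = T * π 1)
    (x : essentialSpace π) : (restrictEssential π T hT x : E) = T x := rfl

theorem star_restrictEssential_apply (T : E →L[ℂ] E) (hT : π 1 * T * π 1 = T * π 1)
    (x : essentialSpace π) : (star (restrictEssential π T hT) x : E) = π 1 (star T x) := by
  have hsa : star (π 1) = π 1 := by rw [← map_star, star_one]
  have hmem : π 1 (star T x) ∈ essentialSpace π := by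
    rw [mem_essentialSpace, ← mul_apply_eq_comp, map_one_mul_map]
  suffices star (restrictEssential π T hT) x = ⟨_, hmem⟩ by rw [this]
  refine ext_inner_right ℂ fun y => ?_
  rw [ContinuousLinearMap.star_eq_adjoint, ContinuousLinearMap.adjoint_inner_left]
  rw [Submodule.coe_inner, Submodule.coe_inner, coe_restrictEssential]
  have e : π 1 (star T x) = ContinuousLinearMap.adjoint (π 1) (star T (x : E)) := by
    rw [← ContinuousLinearMap.star_eq_adjoint, hsa]
  simp only [e]
  rw [ContinuousLinearMap.adjoint_inner_left, (mem_essentialSpace π).1 y.2,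
    ContinuousLinearMap.star_eq_adjoint, ContinuousLinearMap.adjoint_inner_left]

/-- The unital representation obtained by restriction to the essential space. -/
noncomputable def essentialRep : A →⋆ₐ[ℂ] (essentialSpace π →L[ℂ] essentialSpace π) where
  toFun a := restrictEssential π (π a) (by rw [map_one_mul_map])
  map_one' := by
    ext x; simpa using (mem_essentialSpace π).1 x.2
  map_mul' a b := by ext x; simp
  map_zero' := by ext x; simp
  map_add' a b := by ext x; simp
  commutes' r := by
    ext x
    simp [Algebra.algebraMap_eq_smul_one, (mem_essentialSpace π).1 x.2]
  map_star' a := by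
    ext x
    rw [star_restrictEssential_apply, coe_restrictEssential, map_star,
      ← mul_apply_eq_comp, ← map_star, map_one_mul_map]

@[simp]
theorem coe_essentialRep_apply (a : A) (x : essentialSpace π) :
    (essentialRep π a x : E) = π a x := rfl

theorem eq_zero_of_essentialRep_eq_zero {a : A} (ha : essentialRep π a = 0) : π a = 0 := by
  ext x
  have hmem : π 1 x ∈ essentialSpace π := by
    rw [mem_essentialSpace, ← mul_apply_eq_comp, map_one_mul_map]
  have := congrArg (fun T => ((T ⟨_, hmem⟩ : essentialSpace π) : E)) ha
  simpa [← mul_apply_eq_comp, map_mul_map_one] using this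

/-- A nondegenerate covariant pair is obtained from a degenerate one by restriction to the
essential space. -/
theorem exists_isCovariantPair_essentialSpace {α : S →* (A →⋆ₙₐ[ℂ] A)} (U : S →* (E →L[ℂ] E))
    (hU : ∀ s, star (U s) * U s = 1) (hcov : ∀ s a, π (α s a) = U s * π a * star (U s)) :
    ∃ V : S →* (essentialSpace π →L[ℂ] essentialSpace π),
      IsCovariantPair (D := essentialSpace π →L[ℂ] essentialSpace π) α (essentialRep π) V := by
  have hinter : ∀ s a, U s * π a = π (α s a) * U s := fun s a => by
    rw [hcov, mul_assoc, hU, mul_one]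
  -- `U s` carries the range of `π 1` into that of `π (α s 1)`, a subprojection of `π 1`. Invariance
  -- may fail for the adjoint, so a unitary `U s` restricts only to an isometry.
  have hinv : ∀ s, π 1 * U s * π 1 = U s * π 1 := fun s => by
    rw [mul_assoc, hinter, ← mul_assoc, map_one_mul_map]
  refine ⟨{ toFun := fun s => restrictEssential π (U s) (hinv s)
            map_one' := by ext x; simp
            map_mul' := fun s t => by ext x; simp }, fun s => ?_, fun s a => ?_⟩
  · ext x
    have hx := (mem_essentialSpace π).1 x.2
    simp only [MonoidHom.coe_mk, OneHom.coe_mk, mul_apply_eq_comp,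
      one_apply_eq_self, star_restrictEssential_apply, coe_restrictEssential]
    rw [← mul_apply_eq_comp (star (U s)), hU]
    exact hx
  · ext x
    simp only [MonoidHom.coe_mk, OneHom.coe_mk, mul_apply_eq_comp,
      star_restrictEssential_apply, coe_restrictEssential, coe_essentialRep_apply]
    rw [hcov, ← mul_apply_eq_comp (π a), map_mul_map_one]
    rfl

end Compression

/-! ### Diagonal and translation operators on `ℓ²`, and the regular covariant pair -/

section Diagonal

variable {ι K : Type*} [NormedAddCommGroup K]

theorem Memℓp.comp_equiv {f : ι → K} (hf : Memℓp f 2) (e : ι ≃ ι) : Memℓp (fun i => f (e i)) 2 := by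
  have h2 : 0 < (2 : ℝ≥0∞).toReal := by simp
  exact memℓp_gen ((e.summable_iff (f := fun i => ‖f i‖ ^ (2 : ℝ≥0∞).toReal)).2 (hf.summable h2))

variable [InnerProductSpace ℂ K]

/-- The permutation operator `f ↦ f ∘ e` on `ℓ²(ι, K)`. -/
noncomputable def permutationIsometry (e : ι ≃ ι) :
    lp (fun _ : ι => K) 2 ≃ₗᵢ[ℂ] lp (fun _ : ι => K) 2 where
  toFun f := ⟨fun i => f (e i), (lp.memℓp f).comp_equiv e⟩
  invFun f := ⟨fun i => f (e.symm i), (lp.memℓp f).comp_equiv e.symm⟩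
  map_add' _ _ := rfl
  map_smul' _ _ := rfl
  left_inv f := by ext i; simp
  right_inv f := by ext i; simp
  norm_map' f := by
    have h2 : 0 < (2 : ℝ≥0∞).toReal := by simp
    rw [lp.norm_eq_tsum_rpow h2, lp.norm_eq_tsum_rpow h2]
    congr 1
    exact e.tsum_eq (fun i => ‖f i‖ ^ (2 : ℝ≥0∞).toReal)

@[simp]
theorem permutationIsometry_apply (e : ι ≃ ι) (f : lp (fun _ : ι => K) 2) (i : ι) :
    permutationIsometry e f i = f (e i) := rfl

/-- The diagonal operator on `ℓ²(ι, K)` given by a bounded family of operators on `K`. -/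
noncomputable def diagonalOperator (T : ι → K →L[ℂ] K) (C : ℝ) (hT : ∀ i, ‖T i‖ ≤ C) :
    lp (fun _ : ι => K) 2 →L[ℂ] lp (fun _ : ι => K) 2 :=
  have hle : ∀ (f : lp (fun _ : ι => K) 2) (i : ι), ‖T i (f i)‖ ≤ ‖(C • f) i‖ := fun f i => by
    rw [lp.coeFn_smul, Pi.smul_apply, norm_smul]
    exact ((T i).le_opNorm _).trans (mul_le_mul_of_nonneg_right
      ((hT i).trans (le_abs_self C)) (norm_nonneg _))
  have hmem : ∀ f : lp (fun _ : ι => K) 2, Memℓp (fun i => T i (f i)) 2 := fun f =>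
    (lp.memℓp (C • f)).mono' (hle f)
  LinearMap.mkContinuous
    { toFun := fun f => ⟨fun i => T i (f i), hmem f⟩
      map_add' := fun f g => by ext i; exact map_add (T i) _ _
      map_smul' := fun c f => by ext i; exact map_smul (T i) _ _ } |C| fun f => by
    rw [← Real.norm_eq_abs, ← norm_smul]
    exact lp.norm_mono (by simp) (hle f)

@[simp]
theorem diagonalOperator_apply (T : ι → K →L[ℂ] K) (C : ℝ) (hT : ∀ i, ‖T i‖ ≤ C)
    (f : lp (fun _ : ι => K) 2) (i : ι) : diagonalOperator T C hT f i = T i (f i) := rfl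

/-- The diagonal representation on `ℓ²(ι, K)` given by a family of representations on `K`. -/
noncomputable def diagonalRep [CompleteSpace K] {A : Type*} [CStarAlgebra A]
    (σ : ι → A →⋆ₙₐ[ℂ] (K →L[ℂ] K)) :
    A →⋆ₙₐ[ℂ] (lp (fun _ : ι => K) 2 →L[ℂ] lp (fun _ : ι => K) 2) where
  toFun a := diagonalOperator (fun i => σ i a) ‖a‖
    fun i => NonUnitalStarAlgHom.norm_apply_le (σ i) a
  map_smul' c a := by ext f i; simp
  map_zero' := by ext f i; simp
  map_add' a b := by ext f i; simp
  map_mul' a b := by ext f i; simp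
  map_star' a := by
    rw [ContinuousLinearMap.star_eq_adjoint, ContinuousLinearMap.eq_adjoint_iff]
    intro f g
    rw [lp.inner_eq_tsum, lp.inner_eq_tsum]
    congr 1
    funext i
    rw [diagonalOperator_apply, diagonalOperator_apply, map_star,
      ContinuousLinearMap.star_eq_adjoint, ContinuousLinearMap.adjoint_inner_left]

@[simp]
theorem diagonalRep_apply [CompleteSpace K] {A : Type*} [CStarAlgebra A]
    (σ : ι → A →⋆ₙₐ[ℂ] (K →L[ℂ] K)) (a : A) (f : lp (fun _ : ι => K) 2) (i : ι) :
    diagonalRep σ a f i = σ i a (f i) := rfl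

theorem diagonalRep_eq_zero [CompleteSpace K] {A : Type*} [CStarAlgebra A]
    (σ : ι → A →⋆ₙₐ[ℂ] (K →L[ℂ] K)) {a : A} (ha : diagonalRep σ a = 0) (i : ι) : σ i a = 0 := by
  classical
  ext x
  have := congrArg (fun T => (T (lp.single 2 i x) : lp (fun _ : ι => K) 2) i) ha
  simpa using this

end Diagonal

/-- The regular covariant pair of a family of representations that is compatible with the right
translations by `S` on the group `G`. -/
theorem exists_isCovariantPair_of_family {A : Type u} {S : Type v} {G : Type v}
    {K : Type (max u v)} [CStarAlgebra A] [Monoid S] [Monoid G]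
    [NormedAddCommGroup K] [InnerProductSpace ℂ K] [CompleteSpace K] {α : S →* (A →⋆ₙₐ[ℂ] A)}
    (q : S →* G) (hq : ∀ s, IsUnit (q s)) (σ : G → A →⋆ₙₐ[ℂ] (K →L[ℂ] K))
    (hσ : ∀ g s a, σ (g * q s) a = σ g (α s a)) :
    ∃ (H : Type (max u v)) (_ : NormedAddCommGroup H) (_ : InnerProductSpace ℂ H)
      (_ : CompleteSpace H) (π : A →⋆ₐ[ℂ] (H →L[ℂ] H)) (V : S →* (H →L[ℂ] H)),
      IsCovariantPair α π V ∧ ∀ a, π a = 0 → ∀ g, σ g a = 0 := by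
  -- Invertibility of `q s` makes right translation a bijection, hence `U s` unitary; covariance
  -- then reduces to an intertwining relation.
  let e : S → G ≃ G := fun s => (hq s).unit.mulRight
  let W : S → lp (fun _ : G => K) 2 ≃ₗᵢ[ℂ] lp (fun _ : G => K) 2 := fun s =>
    permutationIsometry (e s)
  have he : ∀ s g, e s g = g * q s := fun s g => rfl
  let U : S →* (lp (fun _ : G => K) 2 →L[ℂ] lp (fun _ : G => K) 2) :=
    { toFun := fun s => ((W s).toContinuousLinearEquiv : _ →L[ℂ] _)
      map_one' := by ext f g; simp [W, he]
      map_mul' := fun s t => by ext f g; simp [W, he, mul_assoc] }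
  have hstar : ∀ s, star (U s) = ((W s).symm.toContinuousLinearEquiv : _ →L[ℂ] _) := fun s => by
    rw [ContinuousLinearMap.star_eq_adjoint]
    exact LinearIsometryEquiv.adjoint_eq_symm (W s)
  obtain ⟨V, hV⟩ := exists_isCovariantPair_essentialSpace (α := α) (diagonalRep σ) U
    (fun s => by rw [hstar]; ext1 f; exact (W s).symm_apply_apply f)
    (fun s a => by
      -- At `g` the two sides are `σ g (α s a)` and `σ (g * q s) a`, both applied to `f (g * q s)`.
      have hc : diagonalRep σ (α s a) * U s = U s * diagonalRep σ a := by
        ext f g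
        simp [U, W, he, hσ]
      have hu : U s * star (U s) = 1 := by
        rw [hstar]; ext1 f; exact (W s).apply_symm_apply f
      rw [← hc, mul_assoc, hu, mul_one])
  exact ⟨_, inferInstance, inferInstance, inferInstance, essentialRep (diagonalRep σ), V, hV,
    fun a ha => diagonalRep_eq_zero σ (eq_zero_of_essentialRep_eq_zero _ ha)⟩

/-! ### Norming states, positivity and the GNS representation -/

section States

variable {A : Type*} [CStarAlgebra A]

/-- The real parts are at most `m` and `n` and attain the sum, so `a.re = m`; then `‖a‖ ≤ m` leaves
no room for an imaginary part. -/
theorem Complex.eq_ofReal_of_add_eq {a b : ℂ} {m n : ℝ} (ha : ‖a‖ ≤ m) (hb : ‖b‖ ≤ n)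
    (hab : a + b = m + n) : a = m := by
  have h1 := (Complex.re_le_norm a).trans ha
  have h2 := (Complex.re_le_norm b).trans hb
  have h3 : a.re + b.re = m + n := by simpa using congrArg Complex.re hab
  have hre : a.re = m := by linarith
  have him : a.im = 0 := by
    have := Complex.sq_norm a
    rw [Complex.normSq_apply] at this
    nlinarith [norm_nonneg a]
  exact Complex.ext (by simpa using hre) (by simpa using him)

/-- A positive element is normed by a state. -/
theorem exists_state_apply_eq_norm [Nontrivial A] (z : A) :
    ∃ φ : StrongDual ℂ A, ‖φ‖ ≤ 1 ∧ φ 1 = 1 ∧ φ (star z * z) = ‖star z * z‖ := by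
  let _ := CStarAlgebra.spectralOrder A
  have := CStarAlgebra.spectralOrderedRing A
  set c := star z * z with hc
  have hc0 : 0 ≤ c := star_mul_self_nonneg z
  -- Norming `c + 1` instead of `c` forces extremal values at `c` and at `1` simultaneously, because
  -- `‖c + 1‖ = ‖c‖ + 1`.
  obtain ⟨φ, hφ, hφ1⟩ := exists_dual_vector'' ℂ (c + 1)
  have hn : ‖c + 1‖ = ‖c‖ + 1 := by
    refine le_antisymm ((norm_add_le _ _).trans (by rw [CStarRing.norm_one])) ?_
    have h1 := CStarAlgebra.norm_mem_spectrum_of_nonneg hc0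
    have h2 : ‖c‖ + 1 ∈ spectrum ℝ (c + algebraMap ℝ A 1) := by
      rwa [← spectrum.add_mem_add_iff (s := 1), add_comm _ c] at h1
    rw [map_one] at h2
    exact (Real.le_norm_self _).trans (spectrum.norm_le_norm_of_mem h2)
  have hb : ∀ x : A, ‖φ x‖ ≤ ‖x‖ := fun x =>
    (φ.le_opNorm x).trans (mul_le_of_le_one_left (norm_nonneg _) hφ)
  have hone : ‖φ 1‖ ≤ 1 := (hb 1).trans (by rw [CStarRing.norm_one])
  have hsum : φ c + φ 1 = (‖c‖ : ℝ) + (1 : ℝ) := by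
    rw [← map_add, hφ1, hn]; push_cast; rfl
  refine ⟨φ, hφ, ?_, Complex.eq_ofReal_of_add_eq (hb c) hone hsum⟩
  have := Complex.eq_ofReal_of_add_eq hone (hb c) (by rw [add_comm, hsum, add_comm])
  simpa using this

open scoped ComplexOrder in
/-- A contractive unital functional is positive. -/
theorem StrongDual.nonneg_of_norm_le_one [PartialOrder A] [StarOrderedRing A]
    {φ : StrongDual ℂ A} (hφ : ‖φ‖ ≤ 1) (h1 : φ 1 = 1) {x : A} (hx : 0 ≤ x) : 0 ≤ φ x := by
  have hb : ∀ x : A, ‖φ x‖ ≤ ‖x‖ := fun x =>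
    (φ.le_opNorm x).trans (mul_le_of_le_one_left (norm_nonneg _) hφ)
  have hsa : IsSelfAdjoint x := .of_nonneg hx
  have hreal : ∀ r : ℝ, φ (algebraMap ℝ A r) = r := fun r => by
    rw [IsScalarTower.algebraMap_apply ℝ ℂ A, Algebra.algebraMap_eq_smul_one, map_smul, h1]
    simp
  have him : (φ x).im = 0 := by
    -- Contractivity at `x + it`. After cancelling `t ^ 2` the left side is affine in `t` with slope
    -- `2 (φ x).im`, while the right side is constant.
    have key : ∀ t : ℝ, ((φ x).im + t) ^ 2 ≤ ‖x‖ ^ 2 + t ^ 2 := fun t => by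
      set y := x + algebraMap ℂ A (t * Complex.I) with hy
      have h2 : φ y = φ x + t * Complex.I := by
        rw [hy, map_add, Algebra.algebraMap_eq_smul_one, map_smul, h1]; simp
      have h3 : star y * y = x * x + algebraMap ℂ A (t ^ 2) := by
        rw [hy, star_add, hsa.star_eq, ← algebraMap_star_comm]
        have hst : star ((t : ℂ) * Complex.I) = -(t * Complex.I) := by simp
        rw [hst, map_neg, add_mul, mul_add, mul_add, ← Algebra.commutes _ x, neg_mul, neg_mul,
          ← map_mul]
        have : (t * Complex.I) * (t * Complex.I) = -(t : ℂ) ^ 2 := by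
          ring_nf; simp
        rw [this, map_neg]; abel
      have h4 : ‖y‖ ^ 2 ≤ ‖x‖ ^ 2 + t ^ 2 := by
        rw [sq ‖y‖, ← CStarRing.norm_star_mul_self, h3]
        refine (norm_add_le _ _).trans (add_le_add ((norm_mul_le _ _).trans (sq _).ge) ?_)
        rcases subsingleton_or_nontrivial A with hA | hA
        · rw [Subsingleton.elim (algebraMap ℂ A _) 0, norm_zero]; positivity
        · rw [norm_algebraMap']; simp
      have h5 : ((φ x).im + t) ^ 2 ≤ ‖φ y‖ ^ 2 := by
        rw [Complex.sq_norm, Complex.normSq_apply, h2]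
        simp only [Complex.add_im, Complex.add_re, Complex.mul_im, Complex.mul_re,
          Complex.ofReal_re, Complex.ofReal_im, Complex.I_re, Complex.I_im]
        nlinarith [sq_nonneg (φ x).re]
      exact h5.trans ((pow_le_pow_left₀ (norm_nonneg _) (hb y) 2).trans h4)
    by_contra hne
    have h := key ((‖x‖ ^ 2 + 1) / (φ x).im)
    have e : ((φ x).im + (‖x‖ ^ 2 + 1) / (φ x).im) ^ 2 =
        (φ x).im ^ 2 + 2 * (‖x‖ ^ 2 + 1) + ((‖x‖ ^ 2 + 1) / (φ x).im) ^ 2 := by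
      field_simp; ring
    rw [e] at h
    nlinarith [sq_nonneg (φ x).im, sq_nonneg ‖x‖]
  -- Since `φ 1 = 1`, this bounds `‖x‖ - (φ x).re` by `‖x‖`.
  have hnorm : ‖algebraMap ℝ A ‖x‖ - x‖ ≤ ‖x‖ := by
    refine ((CStarAlgebra.mem_Icc_algebraMap_iff_norm_le (norm_nonneg x)).1 ⟨?_, ?_⟩).2
    · exact sub_nonneg.2 hsa.le_algebraMap_norm_self
    · exact sub_le_self _ hx
  have hre : 0 ≤ (φ x).re := by
    have h2 := (Complex.re_le_norm _).trans ((hb _).trans hnorm)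
    rw [map_sub, hreal] at h2
    simp only [Complex.sub_re, Complex.ofReal_re] at h2
    linarith
  exact Complex.nonneg_iff.2 ⟨hre, him.symm⟩

end States

open scoped ComplexOrder in
/-- The representation on a Hilbert space attached to a state. -/
theorem exists_rep_of_state {L : Type u} [CStarAlgebra L] {Φ : StrongDual ℂ L} (hΦ : ‖Φ‖ ≤ 1)
    (h1 : Φ 1 = 1) :
    ∃ (K : Type u) (_ : NormedAddCommGroup K) (_ : InnerProductSpace ℂ K) (_ : CompleteSpace K)
      (ρ : L →⋆ₐ[ℂ] (K →L[ℂ] K)), ∀ f, (ρ f = 0 → Φ (star f * f) = 0) ∧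
        ((∀ g, Φ (star g * star f * f * g) = 0) → ρ f = 0) := by
  let _ := CStarAlgebra.spectralOrder L
  have := CStarAlgebra.spectralOrderedRing L
  let Ψ : L →ₚ[ℂ] ℂ := PositiveLinearMap.mk₀ (Φ : L →ₗ[ℂ] ℂ)
    fun x hx => StrongDual.nonneg_of_norm_le_one hΦ h1 hx
  refine ⟨Ψ.GNS, inferInstance, inferInstance, inferInstance, Ψ.gnsStarAlgHom, fun f => ⟨?_, ?_⟩⟩
  · intro h
    have h2 : Ψ.gnsNonUnitalStarAlgHom f ((Ψ.toPreGNS 1 : Ψ.PreGNS) : Ψ.GNS) = 0 :=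
      congrArg (fun T : Ψ.GNS →L[ℂ] Ψ.GNS => T ((Ψ.toPreGNS 1 : Ψ.PreGNS) : Ψ.GNS)) h
    rw [PositiveLinearMap.gnsNonUnitalStarAlgHom_apply_coe, ← norm_eq_zero,
      UniformSpace.Completion.norm_coe] at h2
    have h3 := Ψ.preGNS_norm_sq (Ψ.leftMulMapPreGNS f (Ψ.toPreGNS 1))
    rw [h2] at h3
    have h4 : Ψ (star (f * 1) * (f * 1)) = 0 := by
      refine Eq.trans h3.symm (by simp)
    have h5 : Φ (star (f * 1) * (f * 1)) = 0 := h4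
    simpa using h5
  · intro h
    change Ψ.gnsNonUnitalStarAlgHom f = 0
    ext b
    induction b using UniformSpace.Completion.induction_on with
    | hp => exact isClosed_eq (by fun_prop) (by fun_prop)
    | ih b =>
      rw [PositiveLinearMap.gnsNonUnitalStarAlgHom_apply_coe, zero_apply, ← norm_eq_zero,
        UniformSpace.Completion.norm_coe]
      have h3 := Ψ.preGNS_norm_sq (Ψ.leftMulMapPreGNS f b)
      have h4 : Ψ (star (f * Ψ.ofPreGNS b) * (f * Ψ.ofPreGNS b)) = 0 := by
        rw [star_mul, ← mul_assoc]; exact h _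
      have h5 : ((‖Ψ.leftMulMapPreGNS f b‖ : ℂ)) ^ 2 = 0 := h3.trans h4
      exact_mod_cast pow_eq_zero_iff (two_ne_zero) |>.1 h5

/-! ### Limits of states on bounded families -/

section BoundedFamilies

variable {A : Type u} {S : Type v} [CStarAlgebra A] [Nontrivial A]

noncomputable instance lpInftyCStarAlgebra : CStarAlgebra (lp (fun _ : S => A) ∞) where

/-- Bounded families of norm one elements survive in a representation that annihilates the
families that vanish along an ultrafilter. -/
theorem exists_rep_lp_infty (𝒰 : Ultrafilter S) (x : lp (fun _ : S => A) ∞) {m : ℝ}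
    (hm : m ≠ 0) (hx : ∀ r, ‖x r‖ = m) :
    ∃ (K : Type (max u v)) (_ : NormedAddCommGroup K) (_ : InnerProductSpace ℂ K)
      (_ : CompleteSpace K) (ρ : lp (fun _ : S => A) ∞ →⋆ₐ[ℂ] (K →L[ℂ] K)),
      ρ x ≠ 0 ∧ ∀ f, (∀ᶠ r in (𝒰 : Filter S), f r = 0) → ρ f = 0 := by
  choose φ hφ hφ1 hφx using fun r => exists_state_apply_eq_norm (x r)
  let ev : S → WeakDual ℂ (lp (fun _ : S => A) ∞) := fun r =>
    StrongDual.toWeakDual ((φ r).comp (lp.evalCLM ℂ (fun _ : S => A) ∞ r))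
  -- Banach–Alaoglu: the states `f ↦ φ r (f r)` converge weak-⋆ along the ultrafilter.
  obtain ⟨Φ, hΦ, hlim⟩ := (WeakDual.isCompact_closedBall (𝕜 := ℂ)
    (0 : StrongDual ℂ (lp (fun _ : S => A) ∞)) 1).ultrafilter_le_nhds (𝒰.map ev) (by
      rw [Filter.le_principal_iff]
      refine Filter.mem_map.2 (Filter.univ_mem' fun r => ?_)
      rw [Set.mem_preimage, Set.mem_preimage, mem_closedBall_zero_iff]
      refine ContinuousLinearMap.opNorm_le_bound _ zero_le_one fun f => ?_
      rw [one_mul]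
      exact ((φ r).le_opNorm _).trans ((mul_le_of_le_one_left (norm_nonneg _) (hφ r)).trans
        (lp.norm_apply_le_norm ENNReal.top_ne_zero f r)))
  have htend : ∀ f, Filter.Tendsto (fun r => φ r (f r)) 𝒰 (nhds (Φ f)) := fun f =>
    ((WeakDual.eval_continuous f).tendsto Φ).comp hlim
  obtain ⟨K, i1, i2, i3, ρ, hρ⟩ := exists_rep_of_state (Φ := WeakDual.toStrongDual Φ)
    (by simpa using hΦ) (tendsto_nhds_unique (htend 1) (by
      simp only [lp.infty_coeFn_one, Pi.one_apply, hφ1]; exact tendsto_const_nhds))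
  refine ⟨K, i1, i2, i3, ρ, fun h => ?_, fun f hf => (hρ f).2 fun g => ?_⟩
  · have h1 : Φ (star x * x) = 0 := (hρ x).1 h
    have h2 : Φ (star x * x) = ((m * m : ℝ) : ℂ) := by
      refine tendsto_nhds_unique (htend _) (tendsto_const_nhds.congr fun r => ?_)
      have : (star x * x : lp (fun _ : S => A) ∞) r = star (x r) * x r := rfl
      rw [this, hφx, CStarRing.norm_star_mul_self, hx]
    rw [h1] at h2
    exact mul_ne_zero hm hm (by exact_mod_cast h2.symm)
  · refine tendsto_nhds_unique (htend _) (tendsto_const_nhds.congr' ?_)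
    filter_upwards [hf] with r hr
    have : (star g * star f * f * g : lp (fun _ : S => A) ∞) r =
      star (g r) * star (f r) * f r * g r := rfl
    rw [this, hr]
    simp

end BoundedFamilies

/-! ### The inductive limit over `S` and a covariant pair that detects a given element -/

section FaithfulPair

variable {A : Type u} {S : Type v} [CStarAlgebra A] [Monoid S]

/-- Reversibility gives `s * r = s * r'` for some `s`, and the injective `α s` cancels. This
replaces right cancellation in `S`, making the levels independent of the chosen `r`. -/
theorem action_eq_of_mul_eq {α : S →* (A →⋆ₙₐ[ℂ] A)} (hS' : IsLeftReversible S)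
    (hα : ∀ s, Function.Injective (α s)) {r r' t : S} (h : r * t = r' * t) : α r = α r' := by
  obtain ⟨s, hs⟩ := hS' r r' t h
  ext a
  refine hα s ?_
  have := congrArg (fun f : A →⋆ₙₐ[ℂ] A => f a) (congrArg α hs)
  rwa [map_mul, map_mul] at this

open Classical in
/-- The component at `w` of the image of `A` at level `t` of the inductive system: `α r` at
`w = r * t`, and `0` at the points outside `S t`. -/
noncomputable def levelComponent (α : S →* (A →⋆ₙₐ[ℂ] A)) (t w : S) : A →⋆ₙₐ[ℂ] A :=
  if h : ∃ r, r * t = w then α h.choose else 0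

theorem levelComponent_mul {α : S →* (A →⋆ₙₐ[ℂ] A)} (hS' : IsLeftReversible S)
    (hα : ∀ s, Function.Injective (α s)) (r t : S) : levelComponent α t (r * t) = α r := by
  have h : ∃ r', r' * t = r * t := ⟨r, rfl⟩
  rw [levelComponent, dif_pos h]
  exact action_eq_of_mul_eq hS' hα h.choose_spec

variable [Nontrivial A]

/-- The embedding of `A` at level `t` of the inductive system into the bounded families on `S`. -/
noncomputable def levelHom (α : S →* (A →⋆ₙₐ[ℂ] A)) (t : S) :
    A →⋆ₙₐ[ℂ] lp (fun _ : S => A) ∞ where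
  toFun a := ⟨fun w => levelComponent α t w a, memℓp_infty ⟨‖a‖, by
    rintro _ ⟨w, rfl⟩; exact NonUnitalStarAlgHom.norm_apply_le _ a⟩⟩
  map_smul' c a := by ext w; exact map_smul (levelComponent α t w) c a
  map_zero' := by ext w; exact map_zero (levelComponent α t w)
  map_add' a b := by ext w; exact map_add (levelComponent α t w) a b
  map_mul' a b := by ext w; exact map_mul (levelComponent α t w) a b
  map_star' a := by ext w; exact map_star (levelComponent α t w) a

theorem levelHom_apply (α : S →* (A →⋆ₙₐ[ℂ] A)) (t w : S) (a : A) :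
    levelHom α t a w = levelComponent α t w a := rfl

/-- The sets `S t` are nonempty and directed downwards: a common left multiple `m` of `s` and `t`
has `S m` inside both `S s` and `S t`. -/
theorem exists_ultrafilter_range_mul_right (hS : IsLeftOre S) :
    ∃ 𝒰 : Ultrafilter S, ∀ t, ∀ᶠ w in (𝒰 : Filter S), ∃ r, r * t = w := by
  have hne : (⨅ t : S, Filter.principal {w : S | ∃ r, r * t = w}).NeBot := by
    refine Filter.iInf_neBot_of_directed (fun s t => ?_) fun t => ?_
    · obtain ⟨s', t', e⟩ := hS s t
      refine ⟨s' * t, ?_, ?_⟩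
      · refine Filter.principal_mono.2 ?_
        rintro _ ⟨r, rfl⟩
        exact ⟨r * t', by rw [mul_assoc, e]⟩
      · refine Filter.principal_mono.2 ?_
        rintro _ ⟨r, rfl⟩
        exact ⟨r * s', mul_assoc _ _ _⟩
    · exact Filter.principal_neBot_iff.2 ⟨t, 1, one_mul t⟩
  exact ⟨Ultrafilter.of _, fun t => Ultrafilter.of_le _
    (Filter.mem_iInf_of_mem t (Filter.mem_principal_self _))⟩

/-- The left Ore and left reversibility conditions are those of a left Ore localization. -/
noncomputable abbrev IsLeftOre.oreSet (hS : IsLeftOre S) (hS' : IsLeftReversible S) :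
    OreLocalization.OreSet (⊤ : Submonoid S) where
  ore_right_cancel t u s h := by
    obtain ⟨s', hs'⟩ := hS' t u s h
    exact ⟨⟨s', trivial⟩, hs'⟩
  oreNum r s := (hS s r).choose_spec.choose
  oreDenom r s := ⟨(hS s r).choose, trivial⟩
  ore_eq r s := (hS s r).choose_spec.choose_spec

/-- Every nonzero element of `A` survives in a covariant representation. -/
theorem exists_isCovariantPair_ne_zero (hS : IsLeftOre S) (hS' : IsLeftReversible S)
    {α : S →* (A →⋆ₙₐ[ℂ] A)} (hα : ∀ s, Function.Injective (α s)) {a : A} (ha : a ≠ 0) :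
    ∃ (H : Type (max u v)) (_ : NormedAddCommGroup H) (_ : InnerProductSpace ℂ H)
      (_ : CompleteSpace H) (π : A →⋆ₐ[ℂ] (H →L[ℂ] H)) (V : S →* (H →L[ℂ] H)),
      IsCovariantPair α π V ∧ π a ≠ 0 := by
  obtain ⟨𝒰, h𝒰⟩ := exists_ultrafilter_range_mul_right hS
  -- The coordinates at level `1` are the `α r a`, all of norm `‖a‖` because injective
  -- `*`-homomorphisms are isometric.
  obtain ⟨K, i1, i2, i3, ρ, hρ, hρ0⟩ := exists_rep_lp_infty 𝒰 (levelHom α 1 a)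
    (norm_ne_zero_iff.2 ha) fun r => by
      have := levelComponent_mul hS' hα r 1
      rw [mul_one] at this
      rw [levelHom_apply, this]
      exact NonUnitalStarAlgHom.norm_map (α r) (hα r) a
  let _ := hS.oreSet hS'
  let P : S → (⊤ : Submonoid S) → (A →⋆ₙₐ[ℂ] (K →L[ℂ] K)) := fun s t =>
    ((ρ : lp (fun _ : S => A) ∞ →⋆ₙₐ[ℂ] (K →L[ℂ] K)).comp (levelHom α t)).comp (α s)
  -- Expanding a fraction by `t` does not change its representation: at `w = x * (t * s)` both
  -- families equal `α (x * t * r) b`, and `ρ` ignores the other coordinates.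
  have hP : ∀ (r t : S) (s : (⊤ : Submonoid S)) (ht : t * s ∈ (⊤ : Submonoid S)),
      P r s = P (t • r) ⟨t * s, ht⟩ := fun r t s ht => by
    ext1 b
    change ρ (levelHom α s (α r b)) = ρ (levelHom α (t * s) (α (t * r) b))
    rw [← sub_eq_zero, ← map_sub]
    refine hρ0 _ ?_
    filter_upwards [h𝒰 (t * s)] with w ⟨x, hx⟩
    subst hx
    rw [lp.coeFn_sub, Pi.sub_apply, levelHom_apply, levelHom_apply, levelComponent_mul hS' hα,
      ← mul_assoc, levelComponent_mul hS' hα, map_mul, map_mul, sub_eq_zero]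
    rfl
  let σ : OreLocalization (⊤ : Submonoid S) S → (A →⋆ₙₐ[ℂ] (K →L[ℂ] K)) :=
    OreLocalization.liftExpand P hP
  let q : S →* OreLocalization (⊤ : Submonoid S) S := OreLocalization.numeratorHom
  obtain ⟨H, j1, j2, j3, π, V, hV, hπ⟩ := exists_isCovariantPair_of_family (α := α) q
    (fun s => OreLocalization.numerator_isUnit (⟨s, trivial⟩ : (⊤ : Submonoid S))) σ
    (fun g s b => by
      induction g with
      | _ r t =>
        change σ ((OreLocalization.oreDiv r t) * (OreLocalization.oreDiv s 1)) b = _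
        rw [OreLocalization.mul_div_one]
        change ρ (levelHom α t (α (r * s) b)) = ρ (levelHom α t (α r (α s b)))
        rw [map_mul]
        rfl)
  refine ⟨H, j1, j2, j3, π, V, hV, fun h0 => hρ ?_⟩
  -- At the identity of the localization `σ` is `ρ` after level `1`, where `a` survives.
  have h1 : σ (OreLocalization.oreDiv 1 1) a = 0 := hπ a h0 _
  have h2 : ρ (levelHom α 1 (α 1 a)) = 0 := h1
  rw [map_one] at h2
  exact h2

end FaithfulPair

/-! ### The corner action on `S⋆AS` and its crossed product -/

section CornerAction

variable {A S D : Type*} [CStarAlgebra A] [Monoid S] [CStarAlgebra D]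
  {α : S →* (A →⋆ₙₐ[ℂ] A)} {π : A →⋆ₐ[ℂ] D} {V : S →* D}

theorem fraction_mem_fractionCStarSubalgebra (hS : IsLeftOre S) (h : IsCovariantPair α π V)
    (s : S) (a : A) : star (V s) * π a * V s ∈ fractionCStarSubalgebra hS h :=
  StarSubalgebra.le_topologicalClosure _ ⟨s, a, rfl⟩

theorem fractionCStarSubalgebra_induction (hS : IsLeftOre S) (h : IsCovariantPair α π V)
    {P : D → Prop} (hP : IsClosed {x | P x}) (hf : ∀ s a, P (star (V s) * π a * V s))
    {x : D} (hx : x ∈ fractionCStarSubalgebra hS h) : P x := by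
  refine closure_minimal (s := (fractionSubalgebra hS h : Set D)) ?_ hP hx
  rintro _ ⟨s, a, rfl⟩
  exact hf s a

theorem isClosed_fractionCStarSubalgebra (hS : IsLeftOre S) (h : IsCovariantPair α π V) :
    IsClosed (fractionCStarSubalgebra hS h : Set D) :=
  StarSubalgebra.isClosed_topologicalClosure _

/-- Rewriting a fraction with denominator a left multiple of `s` places `V s * star (V s) = π (α s
1)` on both sides of another fraction; density and continuity do the rest. -/
theorem conj_mem_fractionCStarSubalgebra (hS : IsLeftOre S) (h : IsCovariantPair α π V)
    (s : S) {x : D} (hx : x ∈ fractionCStarSubalgebra hS h) :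
    V s * x * star (V s) ∈ fractionCStarSubalgebra hS h := by
  refine fractionCStarSubalgebra_induction hS h
    (P := fun x => V s * x * star (V s) ∈ fractionCStarSubalgebra hS h)
    ((isClosed_fractionCStarSubalgebra hS h).preimage (by fun_prop)) (fun t a => ?_) hx
  obtain ⟨s', t', e⟩ := hS t s
  have key : V s * (star (V t) * π a * V t) * star (V s) =
      π (α s 1) * (star (V s') * π (α t' a) * V s') * π (α s 1) := by
    rw [h.expand t' t, ← e, map_mul V, star_mul, ← h.proj]
    simp only [mul_assoc]
  rw [key]
  exact mul_mem (mul_mem (mem_fractionCStarSubalgebra hS h _)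
    (fraction_mem_fractionCStarSubalgebra hS h _ _)) (mem_fractionCStarSubalgebra hS h _)

theorem star_conj_mem_fractionCStarSubalgebra (hS : IsLeftOre S) (h : IsCovariantPair α π V)
    (s : S) {x : D} (hx : x ∈ fractionCStarSubalgebra hS h) :
    star (V s) * x * V s ∈ fractionCStarSubalgebra hS h := by
  refine fractionCStarSubalgebra_induction hS h
    (P := fun x => star (V s) * x * V s ∈ fractionCStarSubalgebra hS h)
    ((isClosed_fractionCStarSubalgebra hS h).preimage (by fun_prop)) (fun t a => ?_) hx
  have key : star (V s) * (star (V t) * π a * V t) * V s =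
      star (V (t * s)) * π a * V (t * s) := by
    rw [map_mul V, star_mul]
    simp only [mul_assoc]
  rw [key]
  exact fraction_mem_fractionCStarSubalgebra hS h _ _

theorem IsCovariantPair.star_mul_mul (h : IsCovariantPair α π V) (s : S) (x : D) :
    star (V s) * (V s * x) = x := by
  rw [← mul_assoc, h.isometry, one_mul]

/-- The action of `S` on `S⋆AS` given by conjugation with the isometries `V s`. -/
noncomputable def cornerAction (hS : IsLeftOre S) (h : IsCovariantPair α π V) :
    S →* (fractionCStarSubalgebra hS h →⋆ₙₐ[ℂ] fractionCStarSubalgebra hS h) where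
  toFun s :=
    { toFun := fun x => ⟨V s * x * star (V s), conj_mem_fractionCStarSubalgebra hS h s x.2⟩
      map_smul' := fun c x => by ext; simp
      map_zero' := by ext; simp
      map_add' := fun x y => by ext; simp [mul_add, add_mul]
      map_mul' := fun x y => by ext; simp [mul_assoc, h.star_mul_mul]
      map_star' := fun x => by ext; simp [mul_assoc] }
  map_one' := by ext x; simp
  map_mul' s t := by
    ext x
    change V (s * t) * (x : D) * star (V (s * t)) = V s * (V t * x * star (V t)) * star (V s)
    rw [map_mul, star_mul]
    simp only [mul_assoc]

@[simp]
theorem coe_cornerAction_apply (hS : IsLeftOre S) (h : IsCovariantPair α π V) (s : S)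
    (x : fractionCStarSubalgebra hS h) :
    (cornerAction hS h s x : D) = V s * x * star (V s) := rfl

theorem isCornerStarIso_cornerAction [Nontrivial D] (hS : IsLeftOre S)
    (h : IsCovariantPair α π V) (s : S) : IsCornerStarIso (cornerAction hS h s) := by
  have hp : V s * star (V s) ∈ fractionCStarSubalgebra hS h := by
    rw [h.proj]; exact mem_fractionCStarSubalgebra hS h _
  refine ⟨⟨V s * star (V s), hp⟩, ⟨?_, ?_⟩, fun h0 => ?_, fun x y hxy => ?_, ?_⟩
  · ext; simp [mul_assoc, h.star_mul_mul]
  · ext; simp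
  · have h1 : V s * star (V s) = 0 := congrArg Subtype.val h0
    have h2 : star (V s) * (V s * star (V s)) * V s = 1 := by
      rw [h.star_mul_mul, h.isometry]
    rw [h1, mul_zero, zero_mul] at h2
    exact zero_ne_one h2
  · have h1 := congrArg (fun z : fractionCStarSubalgebra hS h => star (V s) * z * V s) hxy
    ext
    simpa [mul_assoc, h.star_mul_mul, h.isometry] using h1
  · ext y
    constructor
    · rintro ⟨x, rfl⟩
      refine ⟨cornerAction hS h s x, ?_⟩
      ext
      simp [mul_assoc, h.star_mul_mul]
    · rintro ⟨x, rfl⟩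
      refine ⟨⟨_, star_conj_mem_fractionCStarSubalgebra hS h s x.2⟩, ?_⟩
      ext
      simp [mul_assoc]

end CornerAction

/-- The range of a corner `*`-isomorphism is hereditary. -/
theorem IsCornerStarIso.isHereditary_range {D : Type*} [CStarAlgebra D] {f : D →⋆ₙₐ[ℂ] D}
    (hf : IsCornerStarIso f) : IsHereditary (Set.range f) := by
  obtain ⟨p, hp, -, -, hr⟩ := hf
  have hpp : p * p = p := hp.isIdempotentElem
  have hps : star p = p := hp.isSelfAdjoint
  rw [hr]
  rintro x y ⟨z, hz⟩ ⟨w, hw⟩ ⟨v, hv⟩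
  let _ := CStarAlgebra.spectralOrder D
  have := CStarAlgebra.spectralOrderedRing D
  have hy : y * (1 - p) = 0 := by
    rw [hv, mul_assoc, mul_sub, hpp, mul_one, sub_self, mul_zero]
  -- Compressing `y = x + (y - x)` by `1 - p` yields two positive terms with sum zero, so each
  -- vanishes.
  have hsum : star (z * (1 - p)) * (z * (1 - p)) + star (w * (1 - p)) * (w * (1 - p)) = 0 := by
    have e : star (z * (1 - p)) * (z * (1 - p)) + star (w * (1 - p)) * (w * (1 - p)) =
        star (1 - p) * ((star z * z + star w * w) * (1 - p)) := by
      simp only [star_mul, mul_assoc, mul_add, add_mul]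
    rw [e, ← hz, ← hw, add_sub_cancel, hy, mul_zero]
  have hz0 : z * (1 - p) = 0 := by
    rw [← CStarRing.star_mul_self_eq_zero_iff]
    refine le_antisymm ?_ (star_mul_self_nonneg _)
    rw [← hsum]
    exact le_add_of_nonneg_right (star_mul_self_nonneg _)
  have hzp : z * p = z := by
    rw [mul_sub, mul_one, sub_eq_zero] at hz0
    exact hz0.symm
  refine ⟨x, ?_⟩
  rw [hz, ← mul_assoc, mul_assoc, mul_assoc, hzp, ← mul_assoc, ← hps, ← star_mul, hzp]

/-- The crossed product of `A` is also the crossed product of `S⋆AS`. -/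
theorem IsCrossedProduct.crossedProduct_cornerAction {A : Type u} {S : Type v} {B : Type (max u v)}
    [CStarAlgebra A] [Monoid S] [CStarAlgebra B] (hS : IsLeftOre S) {α : S →* (A →⋆ₙₐ[ℂ] A)}
    {iA : A →⋆ₐ[ℂ] B} {iS : S →* B} (h : IsCrossedProduct α iA iS) :
    IsCrossedProduct (cornerAction hS h.covariant)
      (fractionCStarSubalgebra hS h.covariant).subtype iS where
  covariant := ⟨h.covariant.isometry, fun _ _ => rfl⟩
  universal H _ _ _ π V hπ := by
    have hcov : IsCovariantPair (D := H →L[ℂ] H) α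
        (π.comp (toFractionCStarSubalgebra hS h.covariant)) V := by
      refine ⟨hπ.isometry, fun s a => ?_⟩
      rw [StarAlgHom.comp_apply, StarAlgHom.comp_apply, ← hπ.covariance]
      congr 1
      ext
      exact h.covariant.covariance s a
    obtain ⟨ρ, hρA, hρS⟩ := h.universal H _ V hcov
    refine ⟨ρ, fun x => ?_, hρS⟩
    have hcont : Continuous fun x : fractionCStarSubalgebra hS h.covariant => ρ x :=
      (AddMonoidHomClass.continuous_of_bound ρ 1 fun x => by
        rw [one_mul]; exact NonUnitalStarAlgHom.norm_apply_le ρ x).comp continuous_subtype_val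
    have hcont' : Continuous π := AddMonoidHomClass.continuous_of_bound π 1 fun x => by
      rw [one_mul]; exact NonUnitalStarAlgHom.norm_apply_le π x
    -- The set where `ρ` and `π` agree is closed in `S⋆AS`, hence in `B`; agreement need only be
    -- checked on fractions.
    have hcl := (isClosed_fractionCStarSubalgebra hS
      h.covariant).isClosedEmbedding_subtypeVal.isClosedMap _ (isClosed_eq hcont hcont')
    have hfrac : ∀ s a, ρ (star (iS s) * iA a * iS s) =
        π ⟨_, fraction_mem_fractionCStarSubalgebra hS h.covariant s a⟩ := fun s a => by
      set y : fractionCStarSubalgebra hS h.covariant :=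
        ⟨_, fraction_mem_fractionCStarSubalgebra hS h.covariant s a⟩ with hy
      -- The action of `s` clears the denominator of `y`, so covariance expresses `V s * π y * star
      -- (V s)` through `π` on `A`; compressing by the isometry `V s` recovers `π y`.
      have h1 : cornerAction hS h.covariant s y =
          toFractionCStarSubalgebra hS h.covariant (α s 1 * a * α s 1) := by
        ext
        change iS s * (star (iS s) * iA a * iS s) * star (iS s) = iA (α s 1 * a * α s 1)
        rw [map_mul, map_mul, ← h.covariant.proj]
        simp only [mul_assoc]
      have h2 := hπ.covariance s y
      rw [h1] at h2
      have h3 : V s * star (V s) * π (toFractionCStarSubalgebra hS h.covariant a) *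
          (V s * star (V s)) = V s * π y * star (V s) := by
        rw [← h2, hcov.proj, map_mul, map_mul, map_mul, map_mul]
        rfl
      have h4 := congrArg (fun T => star (V s) * T * V s) h3
      simp only [mul_assoc, hπ.star_mul_mul, hπ.isometry, mul_one] at h4
      change ρ (star (iS s) * iA a * iS s) = π y
      rw [map_mul, map_mul, map_star, hρA, hρS, ← h4, mul_assoc]
      rfl
    obtain ⟨y, hy, hyx⟩ := fractionCStarSubalgebra_induction hS h.covariant hcl
      (fun s a => ⟨⟨_, fraction_mem_fractionCStarSubalgebra hS h.covariant s a⟩, hfrac s a, rfl⟩) x.2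
    rw [← Subtype.ext hyx]
    exact hy
  generates := by
    rw [eq_top_iff, ← h.generates]
    refine StarSubalgebra.topologicalClosure_mono (StarAlgebra.adjoin_mono ?_)
    refine Set.union_subset_union_left _ ?_
    rintro _ ⟨a, rfl⟩
    exact ⟨toFractionCStarSubalgebra hS h.covariant a, rfl⟩

theorem proposition4p4 {A : Type u} {S : Type v} {B : Type (max u v)}
    [CStarAlgebra A] [Nontrivial A] [Monoid S] [CStarAlgebra B]
    (hS : IsLeftOre S) (hS' : IsLeftReversible S)
    (α : S →* (A →⋆ₙₐ[ℂ] A)) (hα : ∀ s, Function.Injective (α s))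
    (iA : A →⋆ₐ[ℂ] B) (iS : S →* B) (h : IsCrossedProduct α iA iS) :
    Function.Injective iA ∧
    ∃ αbar : S →* (fractionCStarSubalgebra hS h.covariant →⋆ₙₐ[ℂ]
        fractionCStarSubalgebra hS h.covariant),
      (∀ s a, αbar s (toFractionCStarSubalgebra hS h.covariant a) =
        toFractionCStarSubalgebra hS h.covariant (α s a)) ∧
      (∀ s, IsCornerStarIso (αbar s)) ∧
      (∀ s, IsHereditary (Set.range (αbar s))) ∧
      IsCrossedProduct αbar (fractionCStarSubalgebra hS h.covariant).subtype iS := by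
  have hinj : Function.Injective iA := by
    rw [injective_iff_map_eq_zero]
    intro a ha
    by_contra hne
    obtain ⟨H, _, _, _, π, V, hV, hπ⟩ := exists_isCovariantPair_ne_zero hS hS' hα hne
    obtain ⟨ρ, hρ, -⟩ := h.universal H π V hV
    exact hπ (by rw [← hρ, ha, map_zero])
  -- Needed for the corner projections to be nonzero.
  have : Nontrivial B := hinj.nontrivial
  refine ⟨hinj, cornerAction hS h.covariant, fun s a => ?_, isCornerStarIso_cornerAction hS _,
    fun s => (isCornerStarIso_cornerAction hS _ s).isHereditary_range, h.crossedProduct_cornerAction hS⟩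
  ext
  exact (h.covariant.covariance s a).symm
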